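/- Martingale characterization of the cost process. Let $T$ be a time horizon, let $\Xi_1,\dots,\Xi_T$ be Polish spaces, let $\Xi=\Xi_1\times\dots\times\Xi_T$, and write $x_{1:t}=(x_1,\dots,x_t)$. Let $P$ and $\tilde P$ be Borel probability measures on $\Xi$ and let $P_{t+1}(\cdot\mid x_{1:t})$ and $\tilde P_{t+1}(\cdot\mid y_{1:t})$, $0\le t<T$, be (any versions of) their regular conditional distributions on $\Xi_{t+1}$ given the history up to time $t$. Let $r\in[1,\infty)$ and let $c\colon\Xi\times\Xi\to[0,\infty)$ be lower semicontinuous. For a cost function $g\ge 0$ put $$w_r(\mu,\nu;g)=\inf_\gamma\Big(\iint g(x,y)^r\,\gamma(dx,dy)\Big)^{1/r}\in[0,\infty],$$ where $\gamma$ runs over the bivariate probability measures with marginals $\mu$ and $\nu$. The cost process $(c_t)_{t=0}^T$ is defined backwards by $c_T=c$ and $$c_{t}(x_{1:t},y_{1:t})=w_r\big(P_{t+1}(\cdot\mid x_{1:t}),\tilde P_{t+1}(\cdot\mid y_{1:t});\,c_{t+1}(x_{1:t},\cdot\,,y_{1:t},\cdot)\big),\qquad t=T-1,\dots,0,$$ and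 is regarded as a process on $\Xi\times\Xi$; assume that the number $c_0$ is finite. For $0\le t<T$ let $\pi_{t+1}(\cdot\mid x_{1:t},y_{1:t})$ be a Markov kernel from $(\Xi_1\times\dots\times\Xi_t)^2$ to $\Xi_{t+1}\times\Xi_{t+1}$, let $$\pi(dx,dy)=\pi_1(dx_1,dy_1)\,\pi_2(dx_2,dy_2\mid x_1,y_1)\cdots\pi_T(dx_T,dy_T\mid x_{1:T-1},y_{1:T-1})$$ be the probability measure on $\Xi\times\Xi$ obtained by gluing these kernels, and suppose that for each $t$ and $\pi$-almost every $(x_{1:t},y_{1:t})$ the measure $\pi_{t+1}(\cdot\mid x_{1:t},y_{1:t})$ has marginals $P_{t+1}(\cdot\mid x_{1:t})$ and $\tilde P_{t+1}(\cdot\mid y_{1:t})$ and attains the infimum that defines $c_t(x_{1:t},y_{1:t})$. Let $\mathcal F_t=\sigma(x\mapsto x_{1:t})$, $0\le t\le T$, be the canonical filtration on $\Xi$. Then $(c_t^r)_{t=0}^T$ is a martingale with respect to $\pi$ and the filtration $(\mathcal F_t\otimes\mathcal F_t)_{t=0}^T$: each $c_t$ is $\pi$-a.s. finite, $c_t^r$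 is $\pi$-integrable and $\pi$-a.s. equal to an $\mathcal F_t\otimes\mathcal F_t$-measurable function, and $$c_s^r=\mathbb E_\pi\big(c_t^r\mid\mathcal F_s\otimes\mathcal F_s\big)\quad\pi\text{-a.s.},\qquad 0\le s\le t\le T;$$ in particular $c_t^r=\mathbb E_\pi(c_{t+1}^r\mid\mathcal F_t\otimes\mathcal F_t)$ for $0\le t<T$. If the kernels are optimal on every fiber $(x_{1:t},y_{1:t})$, then $c_t^r$ itself is $\mathcal F_t\otimes\mathcal F_t$-measurable for every $t$, so that $(c_t^r)_{t=0}^T$ is a martingale in the strict sense. -/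

import Mathlib

open MeasureTheory ProbabilityTheory
open scoped ENNReal

/-! ### Wasserstein distance with a general cost function -/

/-- The bivariate probability measures with marginals `μ` and `ν`. -/
def couplings {X Y : Type*} [MeasurableSpace X] [MeasurableSpace Y]
    (μ : Measure X) (ν : Measure Y) : Set (Measure (X × Y)) :=
  {γ | IsProbabilityMeasure γ ∧ γ.map Prod.fst = μ ∧ γ.map Prod.snd = ν}

/-- The transport cost `(∬ c(x,y)^r γ(dx,dy))^(1/r)` of the bivariate measure `γ`. -/
noncomputable def transportCost {X Y : Type*} [MeasurableSpace X] [MeasurableSpace Y]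
    (r : ℝ) (c : X × Y → ℝ≥0∞) (γ : Measure (X × Y)) : ℝ≥0∞ :=
  (∫⁻ z, c z ^ r ∂γ) ^ (1 / r)

/-- The Wasserstein distance `w_r(μ, ν; c)` of order `r` with respect to the cost function `c`. -/
noncomputable def wasserstein {X Y : Type*} [MeasurableSpace X] [MeasurableSpace Y]
    (r : ℝ) (μ : Measure X) (ν : Measure Y) (c : X × Y → ℝ≥0∞) : ℝ≥0∞ :=
  ⨅ γ ∈ couplings μ ν, transportCost r c γ

/-- The bivariate measure `γ` attains the infimum that defines `w_r(μ, ν; c)`. -/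
def IsOptimalCoupling {X Y : Type*} [MeasurableSpace X] [MeasurableSpace Y]
    (r : ℝ) (μ : Measure X) (ν : Measure Y) (c : X × Y → ℝ≥0∞) (γ : Measure (X × Y)) : Prop :=
  γ ∈ couplings μ ν ∧ transportCost r c γ = wasserstein r μ ν c

/-! ### Histories

The stage spaces are `Ξ 0, Ξ 1, …`, where `Ξ t` is the space of stage `t + 1`; with time horizon `T`
only `Ξ 0, …, Ξ (T - 1)` enter. -/

/-- The space `Ξ_{1:t} = Ξ_1 × ⋯ × Ξ_t` of histories up to time `t` (a single point for `t = 0`). -/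
abbrev Hist (Ξ : ℕ → Type*) (t : ℕ) : Type _ := (i : Fin t) → Ξ i

/-- The projection `x_{1:T} ↦ x_{1:t}`. -/
def trunc {Ξ : ℕ → Type*} {t T : ℕ} (h : t ≤ T) (x : Hist Ξ T) : Hist Ξ t :=
  fun i => x (Fin.castLE h i)

/-- The history `(x_1, …, x_t, ξ)`. -/
def histSnoc {Ξ : ℕ → Type*} {t : ℕ} (x : Hist Ξ t) (ξ : Ξ t) : Hist Ξ (t + 1) :=
  Fin.snoc (α := fun i : Fin (t + 1) => Ξ i) x ξ

/-- The pair of histories `((x_1, …, x_t, ξ), (y_1, …, y_t, η))`. -/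
def histSnocPair {Ξ : ℕ → Type*} {t : ℕ} (z : Hist Ξ t × Hist Ξ t) (w : Ξ t × Ξ t) :
    Hist Ξ (t + 1) × Hist Ξ (t + 1) :=
  (histSnoc z.1 w.1, histSnoc z.2 w.2)

theorem measurable_trunc {Ξ : ℕ → Type*} [∀ t, MeasurableSpace (Ξ t)] {t T : ℕ} (h : t ≤ T) :
    Measurable (trunc h : Hist Ξ T → Hist Ξ t) :=
  measurable_pi_lambda _ fun i => measurable_pi_apply (Fin.castLE h i)

/-! ### Canonical filtration -/

/-- The canonical filtration `F_t = σ(x_{1:t})`, `t = 0, …, T`, on `Ξ_{1:T}`. -/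
def canonicalFiltration (Ξ : ℕ → Type*) [∀ t, MeasurableSpace (Ξ t)] (T : ℕ) :
    Filtration (Fin (T + 1)) (inferInstance : MeasurableSpace (Hist Ξ T)) where
  seq t := MeasurableSpace.comap (trunc t.is_le) inferInstance
  mono' s t hst := by
    have hst' : (s : ℕ) ≤ t := hst
    rintro _ ⟨A, hA, rfl⟩
    exact ⟨trunc hst' ⁻¹' A, measurable_trunc hst' hA, rfl⟩
  le' t := (measurable_trunc t.is_le).comap_le

/-- The product filtration `F_t ⊗ F_t`, `t = 0, …, T`, on `Ξ_{1:T} × Ξ_{1:T}`. -/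
def productFiltration (Ξ : ℕ → Type*) [∀ t, MeasurableSpace (Ξ t)] (T : ℕ) :
    Filtration (Fin (T + 1)) (inferInstance : MeasurableSpace (Hist Ξ T × Hist Ξ T)) where
  seq t := (canonicalFiltration Ξ T t).prod (canonicalFiltration Ξ T t)
  mono' _ _ hst := sup_le_sup
    (MeasurableSpace.comap_mono ((canonicalFiltration Ξ T).mono hst))
    (MeasurableSpace.comap_mono ((canonicalFiltration Ξ T).mono hst))
  le' t := sup_le_sup
    (MeasurableSpace.comap_mono ((canonicalFiltration Ξ T).le t))
    (MeasurableSpace.comap_mono ((canonicalFiltration Ξ T).le t))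

/-! ### Regular conditional kernels, cost process, glued measure -/

/-- `p t` is a regular version of the conditional law of the coordinate of stage `t + 1` under `P`
given the history up to time `t`, for every `t < T`. -/
def IsRegularKernelFamily {Ξ : ℕ → Type*} [∀ t, MeasurableSpace (Ξ t)] {T : ℕ}
    (P : Measure (Hist Ξ T)) (p : (t : Fin T) → Kernel (Hist Ξ t) (Ξ t)) : Prop :=
  ∀ t : Fin T, P.map (trunc t.is_lt.le) ⊗ₘ p t = P.map (fun x => (trunc t.is_lt.le x, x t))

/-- The cost functions `c_t`, `t ≤ T`, as functions of the pair of histories up to time `t`: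
`c_T = c` and `c_t(x, y) = w_r(P_{t+1}(· | x), P'_{t+1}(· | y); c_{t+1}(x, ·, y, ·))` for `t < T`. -/
noncomputable def costFun {Ξ : ℕ → Type*} [∀ t, MeasurableSpace (Ξ t)] {T : ℕ} (r : ℝ)
    (p p' : (t : Fin T) → Kernel (Hist Ξ t) (Ξ t)) (c : Hist Ξ T × Hist Ξ T → ℝ)
    {t : ℕ} (ht : t ≤ T) : Hist Ξ t × Hist Ξ t → ℝ≥0∞ :=
  Nat.decreasingInduction (motive := fun t _ => Hist Ξ t × Hist Ξ t → ℝ≥0∞)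
    (fun t h next z => wasserstein r (p ⟨t, h⟩ z.1) (p' ⟨t, h⟩ z.2) fun w => next (histSnocPair z w))
    (fun z => ENNReal.ofReal (c z)) ht

theorem costFun_self {Ξ : ℕ → Type*} [∀ t, MeasurableSpace (Ξ t)] {T : ℕ} (r : ℝ)
    (p p' : (t : Fin T) → Kernel (Hist Ξ t) (Ξ t)) (c : Hist Ξ T × Hist Ξ T → ℝ)
    (z : Hist Ξ T × Hist Ξ T) :
    costFun r p p' c le_rfl z = ENNReal.ofReal (c z) := by
  unfold costFun
  rw [Nat.decreasingInduction_self]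

theorem costFun_of_lt {Ξ : ℕ → Type*} [∀ t, MeasurableSpace (Ξ t)] {T : ℕ} (r : ℝ)
    (p p' : (t : Fin T) → Kernel (Hist Ξ t) (Ξ t)) (c : Hist Ξ T × Hist Ξ T → ℝ)
    {t : ℕ} (ht : t < T) (z : Hist Ξ t × Hist Ξ t) :
    costFun r p p' c ht.le z = wasserstein r (p ⟨t, ht⟩ z.1) (p' ⟨t, ht⟩ z.2)
      fun w => costFun r p p' c (Nat.succ_le_of_lt ht) (histSnocPair z w) := by
  unfold costFun
  rw [Nat.decreasingInduction_succ_left _ _ (Nat.succ_le_of_lt ht) ht.le]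

/-- The cost process `(c_t)`, `t = 0, …, T`, on `Ξ_{1:T} × Ξ_{1:T}`. -/
noncomputable def costProcess {Ξ : ℕ → Type*} [∀ t, MeasurableSpace (Ξ t)] {T : ℕ} (r : ℝ)
    (p p' : (t : Fin T) → Kernel (Hist Ξ t) (Ξ t)) (c : Hist Ξ T × Hist Ξ T → ℝ)
    (t : Fin (T + 1)) (z : Hist Ξ T × Hist Ξ T) : ℝ≥0∞ :=
  costFun r p p' c t.is_le (trunc t.is_le z.1, trunc t.is_le z.2)

/-- The law on `Ξ_{1:t} × Ξ_{1:t}` obtained by composing the bivariate kernels of the first `t`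
stages: `π_1(dx_1, dy_1) π_2(dx_2, dy_2 | x_1, y_1) ⋯ π_t(dx_t, dy_t | x_{1:t-1}, y_{1:t-1})`. -/
noncomputable def glue {Ξ : ℕ → Type*} [∀ t, MeasurableSpace (Ξ t)] {T : ℕ}
    (K : (t : Fin T) → Kernel (Hist Ξ t × Hist Ξ t) (Ξ t × Ξ t)) :
    (t : ℕ) → t ≤ T → Measure (Hist Ξ t × Hist Ξ t)
  | 0, _ => Measure.dirac (fun i => i.elim0, fun i => i.elim0)
  | t + 1, h => (glue K t (Nat.le_of_succ_le h) ⊗ₘ K ⟨t, h⟩).map fun zw => histSnocPair zw.1 zw.2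

/-- The bivariate measure `π` on `Ξ_{1:T} × Ξ_{1:T}` that governs all the kernels `K t`. -/
noncomputable def gluedMeasure {Ξ : ℕ → Type*} [∀ t, MeasurableSpace (Ξ t)] {T : ℕ}
    (K : (t : Fin T) → Kernel (Hist Ξ t × Hist Ξ t) (Ξ t × Ξ t)) :
    Measure (Hist Ξ T × Hist Ξ T) :=
  glue K T le_rfl

/-- `K t` is optimal in the definition of `c_t` on the fiber `z = (x_{1:t}, y_{1:t})`. -/
def IsOptimalAt {Ξ : ℕ → Type*} [∀ t, MeasurableSpace (Ξ t)] {T : ℕ} (r : ℝ)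
    (p p' : (t : Fin T) → Kernel (Hist Ξ t) (Ξ t)) (c : Hist Ξ T × Hist Ξ T → ℝ)
    (K : (t : Fin T) → Kernel (Hist Ξ t × Hist Ξ t) (Ξ t × Ξ t))
    (t : Fin T) (z : Hist Ξ t × Hist Ξ t) : Prop :=
  IsOptimalCoupling r (p t z.1) (p' t z.2)
    (fun w => costFun r p p' c (Nat.succ_le_of_lt t.is_lt) (histSnocPair z w)) (K t z)

/-! An optimal kernel turns the infimum defining `c_t` into an integral: `c_t^r` is the integral of
`c_{t+1}^r` against `K t` (`IsOptimalAt.costFun_rpow`). As the glued law at `t + 1` disintegrates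
over the one at `t` with kernel `K t`, both variables have the same integral over events known at
time `t` (`setLIntegral_costFun_rpow`). An infimum over couplings need not be measurable, so
a.e.-measurability is carried backwards from `c` through the integral formula. Everything is first
done in `ℝ≥0∞`: there the identity needs no integrability, and from time 0 it yields integrability,
since `c_0` is a finite constant. Only then are the integrals made real. -/

/-! ### Truncation and extension of histories -/

/-- The projection of a pair of histories to the pair of their initial segments. -/
def truncPair {Ξ : ℕ → Type*} {t T : ℕ} (h : t ≤ T) (z : Hist Ξ T × Hist Ξ T) :
    Hist Ξ t × Hist Ξ t :=
  (trunc h z.1, trunc h z.2)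

theorem trunc_histSnoc {Ξ : ℕ → Type*} {t : ℕ} (x : Hist Ξ t) (ξ : Ξ t) :
    trunc t.le_succ (histSnoc x ξ) = x := by
  funext i
  exact Fin.snoc_castSucc (α := fun i : Fin (t + 1) => Ξ i) ξ x i

theorem truncPair_histSnocPair {Ξ : ℕ → Type*} {t : ℕ} (z : Hist Ξ t × Hist Ξ t) (w : Ξ t × Ξ t) :
    truncPair t.le_succ (histSnocPair z w) = z :=
  Prod.ext (trunc_histSnoc _ _) (trunc_histSnoc _ _)

section
variable {Ξ : ℕ → Type*} [∀ t, MeasurableSpace (Ξ t)] {T : ℕ}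

theorem measurable_truncPair {t : ℕ} (h : t ≤ T) :
    Measurable (truncPair h : Hist Ξ T × Hist Ξ T → Hist Ξ t × Hist Ξ t) :=
  ((measurable_trunc h).comp measurable_fst).prodMk ((measurable_trunc h).comp measurable_snd)

theorem measurable_histSnoc {t : ℕ} :
    Measurable fun q : Hist Ξ t × Ξ t => histSnoc q.1 q.2 := by
  refine measurable_pi_lambda _ fun i => ?_
  induction i using Fin.lastCases with
  | last =>
    have : (fun q : Hist Ξ t × Ξ t => histSnoc q.1 q.2 (Fin.last t)) = Prod.snd := by
      funext q
      exact Fin.snoc_last (α := fun i : Fin (t + 1) => Ξ i) q.2 q.1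
    rw [this]
    exact measurable_snd
  | cast i =>
    have : (fun q : Hist Ξ t × Ξ t => histSnoc q.1 q.2 i.castSucc) = fun q => q.1 i := by
      funext q
      exact Fin.snoc_castSucc (α := fun i : Fin (t + 1) => Ξ i) q.2 q.1 i
    rw [this]
    exact (measurable_pi_apply i).comp measurable_fst

theorem measurable_histSnocPair {t : ℕ} :
    Measurable fun q : (Hist Ξ t × Hist Ξ t) × (Ξ t × Ξ t) => histSnocPair q.1 q.2 :=
  (measurable_histSnoc.comp (measurable_fst.fst.prodMk measurable_snd.fst)).prodMk
    (measurable_histSnoc.comp (measurable_fst.snd.prodMk measurable_snd.snd))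

/-- Pull-back commutes with suprema of σ-algebras. Events of the product filtration thus become
`truncPair` preimages. -/
theorem productFiltration_apply (t : Fin (T + 1)) :
    productFiltration Ξ T t = MeasurableSpace.comap (truncPair t.is_le) inferInstance := by
  change MeasurableSpace.prod (MeasurableSpace.comap _ _) (MeasurableSpace.comap _ _) =
    MeasurableSpace.comap _ (MeasurableSpace.prod _ _)
  simp only [MeasurableSpace.prod, MeasurableSpace.comap_sup, MeasurableSpace.comap_comp]
  rfl

/-! ### Marginals and disintegration of the glued laws -/

section glue
variable (K : (t : Fin T) → Kernel (Hist Ξ t × Hist Ξ t) (Ξ t × Ξ t)) [∀ t, IsMarkovKernel (K t)]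

theorem isProbabilityMeasure_glue (t : ℕ) (ht : t ≤ T) : IsProbabilityMeasure (glue K t ht) := by
  induction t with
  | zero => exact inferInstanceAs (IsProbabilityMeasure (Measure.dirac _))
  | succ t ih =>
    have := ih (Nat.le_of_succ_le ht)
    exact Measure.isProbabilityMeasure_map measurable_histSnocPair.aemeasurable

/-- Markov kernels have mass one, so later stages integrate out. -/
theorem map_truncPair_glue {s : ℕ} (t : ℕ) (hst : s ≤ t) (ht : t ≤ T) :
    (glue K t ht).map (truncPair hst) = glue K s (hst.trans ht) := by
  induction t, hst using Nat.le_induction with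
  | base => exact Measure.map_id
  | succ t hst ih =>
    have := isProbabilityMeasure_glue K t (Nat.le_of_succ_le ht)
    rw [← ih (Nat.le_of_succ_le ht), glue,
      Measure.map_map (measurable_truncPair _) measurable_histSnocPair]
    have : (truncPair (Nat.le_succ_of_le hst) ∘
        fun q : (Hist Ξ t × Hist Ξ t) × (Ξ t × Ξ t) => histSnocPair q.1 q.2) =
        truncPair hst ∘ Prod.fst := by
      funext q
      exact congrArg (truncPair hst) (truncPair_histSnocPair q.1 q.2)
    rw [this, ← Measure.map_map (measurable_truncPair _) measurable_fst]
    congr 1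
    exact Measure.fst_compProd _ _

theorem setLIntegral_glue_succ {t : ℕ} (ht : t < T)
    {f : Hist Ξ (t + 1) × Hist Ξ (t + 1) → ℝ≥0∞} (hf : AEMeasurable f (glue K (t + 1) ht))
    {A : Set (Hist Ξ t × Hist Ξ t)} (hA : MeasurableSet A) :
    ∫⁻ z in truncPair t.le_succ ⁻¹' A, f z ∂glue K (t + 1) ht =
      ∫⁻ z in A, ∫⁻ w, f (histSnocPair z w) ∂K ⟨t, ht⟩ z ∂glue K t ht.le := by
  have := isProbabilityMeasure_glue K t ht.le
  have hpre : (fun q : (Hist Ξ t × Hist Ξ t) × (Ξ t × Ξ t) => histSnocPair q.1 q.2) ⁻¹'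
      (truncPair t.le_succ ⁻¹' A) = A ×ˢ Set.univ := by
    ext q
    simp [truncPair_histSnocPair]
  have hcomp : AEMeasurable (fun q : (Hist Ξ t × Hist Ξ t) × (Ξ t × Ξ t) =>
      f (histSnocPair q.1 q.2)) (glue K t ht.le ⊗ₘ K ⟨t, ht⟩) :=
    hf.comp_measurable measurable_histSnocPair
  rw [glue] at hf ⊢
  rw [Measure.restrict_map measurable_histSnocPair (measurable_truncPair _ hA), hpre,
    lintegral_map' ?_ measurable_histSnocPair.aemeasurable,
    -- Tonelli is applied to a measurable version; on almost every fiber it agrees with `f` almost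
    -- everywhere, so `f` can be put back.
    lintegral_congr_ae (ae_restrict_of_ae hcomp.ae_eq_mk),
    Measure.setLIntegral_compProd hcomp.measurable_mk hA MeasurableSet.univ]
  · refine lintegral_congr_ae (ae_restrict_of_ae ?_)
    filter_upwards [Measure.ae_ae_of_ae_compProd hcomp.ae_eq_mk] with z hz
    rw [Measure.restrict_univ]
    exact (lintegral_congr_ae hz).symm
  · rw [← hpre, ← Measure.restrict_map measurable_histSnocPair (measurable_truncPair _ hA)]
    exact hf.restrict

theorem aemeasurable_lintegral_glue {t : ℕ} (ht : t < T)
    {f : Hist Ξ (t + 1) × Hist Ξ (t + 1) → ℝ≥0∞} (hf : AEMeasurable f (glue K (t + 1) ht)) :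
    AEMeasurable (fun z => ∫⁻ w, f (histSnocPair z w) ∂K ⟨t, ht⟩ z) (glue K t ht.le) := by
  have := isProbabilityMeasure_glue K t ht.le
  have hcomp : AEMeasurable (fun q : (Hist Ξ t × Hist Ξ t) × (Ξ t × Ξ t) =>
      f (histSnocPair q.1 q.2)) (glue K t ht.le ⊗ₘ K ⟨t, ht⟩) :=
    hf.comp_measurable measurable_histSnocPair
  refine ⟨fun z => ∫⁻ w, hcomp.mk _ (z, w) ∂K ⟨t, ht⟩ z,
    hcomp.measurable_mk.lintegral_kernel_prod_right', ?_⟩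
  filter_upwards [Measure.ae_ae_of_ae_compProd hcomp.ae_eq_mk] with z hz
  exact lintegral_congr_ae hz

end glue

/-! ### The one-step recursion and its iterates -/

section cost
variable {r : ℝ} {p p' : (t : Fin T) → Kernel (Hist Ξ t) (Ξ t)} {c : Hist Ξ T × Hist Ξ T → ℝ}
  {K : (t : Fin T) → Kernel (Hist Ξ t × Hist Ξ t) (Ξ t × Ξ t)}

theorem IsOptimalAt.costFun_rpow (hr : 1 ≤ r) {t : ℕ} {ht : t < T} {z : Hist Ξ t × Hist Ξ t}
    (h : IsOptimalAt r p p' c K ⟨t, ht⟩ z) :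
    costFun r p p' c ht.le z ^ r = ∫⁻ w,
      costFun r p p' c (Nat.succ_le_of_lt ht) (histSnocPair z w) ^ r ∂K ⟨t, ht⟩ z := by
  rw [costFun_of_lt r p p' c ht z]
  refine (congrArg (· ^ r) h.2.symm).trans ?_
  exact ENNReal.rpow_inv_rpow (by positivity : r ≠ 0) _ |> (by simpa [transportCost] using ·)

theorem measurable_costFun_self (hc : Measurable c) :
    Measurable (costFun r p p' c le_rfl) := by
  rw [funext (costFun_self r p p' c)]
  exact hc.ennreal_ofReal

theorem measurable_costFun_rpow [∀ t, IsMarkovKernel (K t)] (hr : 1 ≤ r) (hc : Measurable c)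
    (hK : ∀ t z, IsOptimalAt r p p' c K t z) (t : ℕ) (ht : t ≤ T) :
    Measurable fun z => costFun r p p' c ht z ^ r := by
  induction ht using Nat.decreasingInduction with
  | self => exact (measurable_costFun_self hc).pow_const r
  | of_succ t ht ih =>
    rw [funext fun z => (hK ⟨t, ht⟩ z).costFun_rpow hr]
    exact (ih.comp measurable_histSnocPair).lintegral_kernel_prod_right'

variable [∀ t, IsMarkovKernel (K t)]

/-- Backward induction: at each stage the fibers without optimality form a null set for the glued
law of that stage, which a.e.-measurability ignores. -/
theorem aemeasurable_costFun_rpow (hr : 1 ≤ r) (hc : Measurable c)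
    (hK : ∀ t : Fin T, ∀ᵐ z ∂(glue K t t.is_lt.le), IsOptimalAt r p p' c K t z)
    (t : ℕ) (ht : t ≤ T) :
    AEMeasurable (fun z => costFun r p p' c ht z ^ r) (glue K t ht) := by
  induction ht using Nat.decreasingInduction with
  | self => exact ((measurable_costFun_self hc).pow_const r).aemeasurable
  | of_succ t ht ih =>
    refine (aemeasurable_lintegral_glue K ht ih).congr ?_
    filter_upwards [hK ⟨t, ht⟩] with z hz
    exact (hz.costFun_rpow hr).symm

theorem setLIntegral_costFun_rpow (hr : 1 ≤ r) (hc : Measurable c)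
    (hK : ∀ t : Fin T, ∀ᵐ z ∂(glue K t t.is_lt.le), IsOptimalAt r p p' c K t z)
    {s : ℕ} (t : ℕ) (hst : s ≤ t) (ht : t ≤ T)
    {A : Set (Hist Ξ s × Hist Ξ s)} (hA : MeasurableSet A) :
    ∫⁻ z in truncPair hst ⁻¹' A, costFun r p p' c ht z ^ r ∂glue K t ht =
      ∫⁻ z in A, costFun r p p' c (hst.trans ht) z ^ r ∂glue K s (hst.trans ht) := by
  induction t, hst using Nat.le_induction with
  | base => rfl
  | succ t hst ih =>
    rw [← ih (Nat.le_of_succ_le ht)]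
    -- Truncation to `s` factors through truncation to `t`, so the event is a pull-back from time
    -- `t`.
    refine (setLIntegral_glue_succ K ht (aemeasurable_costFun_rpow hr hc hK (t + 1) ht)
      (measurable_truncPair hst hA)).trans ?_
    refine lintegral_congr_ae (ae_restrict_of_ae ?_)
    filter_upwards [hK ⟨t, ht⟩] with z hz
    exact (hz.costFun_rpow hr).symm

/-! ### The cost process on the full path space -/

theorem aemeasurable_costProcess_rpow (hr : 1 ≤ r) (hc : Measurable c)
    (hK : ∀ t : Fin T, ∀ᵐ z ∂(glue K t t.is_lt.le), IsOptimalAt r p p' c K t z)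
    (t : Fin (T + 1)) :
    AEMeasurable (fun z => costProcess r p p' c t z ^ r) (gluedMeasure K) := by
  have h := aemeasurable_costFun_rpow hr hc hK t t.is_le
  rw [← map_truncPair_glue K T t.is_le le_rfl] at h
  exact h.comp_measurable (measurable_truncPair _)

theorem setLIntegral_costProcess_rpow (hr : 1 ≤ r) (hc : Measurable c)
    (hK : ∀ t : Fin T, ∀ᵐ z ∂(glue K t t.is_lt.le), IsOptimalAt r p p' c K t z)
    {s t : Fin (T + 1)} (hst : s ≤ t) {A : Set (Hist Ξ T × Hist Ξ T)}
    (hA : MeasurableSet[productFiltration Ξ T s] A) :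
    ∫⁻ z in A, costProcess r p p' c s z ^ r ∂gluedMeasure K =
      ∫⁻ z in A, costProcess r p p' c t z ^ r ∂gluedMeasure K := by
  rw [productFiltration_apply] at hA
  obtain ⟨B, hB, rfl⟩ := hA
  have key : ∀ u : Fin (T + 1), ∀ h : s ≤ u,
      ∫⁻ z in truncPair s.is_le ⁻¹' B, costProcess r p p' c u z ^ r ∂gluedMeasure K =
        ∫⁻ z in B, costFun r p p' c s.is_le z ^ r ∂glue K s s.is_le := by
    intro u h
    have hm := aemeasurable_costFun_rpow hr hc hK u u.is_le
    rw [← setLIntegral_costFun_rpow hr hc hK u h u.is_le hB]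
    rw [← map_truncPair_glue K T u.is_le le_rfl] at hm ⊢
    rw [Measure.restrict_map (measurable_truncPair _) (measurable_truncPair _ hB),
      lintegral_map' ?_ (measurable_truncPair _).aemeasurable]
    · rfl
    · rw [← Measure.restrict_map (measurable_truncPair _) (measurable_truncPair _ hB)]
      exact hm.restrict
  rw [key s le_rfl, key t hst]

/-- On the whole space, comparison with time 0 gives the value `c_0^r`. -/
theorem lintegral_costProcess_rpow_ne_top (hr : 1 ≤ r) (hc : Measurable c)
    (hK : ∀ t : Fin T, ∀ᵐ z ∂(glue K t t.is_lt.le), IsOptimalAt r p p' c K t z)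
    (hfin : ∀ z, costProcess r p p' c 0 z ≠ ∞) (t : Fin (T + 1)) :
    ∫⁻ z, costProcess r p p' c t z ^ r ∂gluedMeasure K ≠ ∞ := by
  have hprob : IsProbabilityMeasure (gluedMeasure K) := isProbabilityMeasure_glue K T le_rfl
  have h := setLIntegral_costProcess_rpow hr hc hK (Fin.zero_le t) MeasurableSet.univ
  rw [setLIntegral_univ, setLIntegral_univ] at h
  rw [← h]
  obtain ⟨z₀⟩ : Nonempty (Hist Ξ T × Hist Ξ T) := nonempty_of_isProbabilityMeasure (gluedMeasure K)
  have hconst : (fun z => costProcess r p p' c 0 z ^ r) =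
      fun _ => costProcess r p p' c 0 z₀ ^ r := by
    funext z
    -- There is only one history of length 0.
    have : truncPair (Fin.is_le (0 : Fin (T + 1))) z = truncPair (Fin.is_le 0) z₀ :=
      Prod.ext (funext fun i => i.elim0) (funext fun i => i.elim0)
    exact congrArg (fun y => costFun r p p' c (Fin.is_le 0) y ^ r) this
  rw [hconst, lintegral_const, measure_univ, mul_one]
  exact ENNReal.rpow_ne_top_of_nonneg (by linarith) (hfin z₀)

theorem ae_costProcess_ne_top (hr : 1 ≤ r) (hc : Measurable c)
    (hK : ∀ t : Fin T, ∀ᵐ z ∂(glue K t t.is_lt.le), IsOptimalAt r p p' c K t z)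
    (hfin : ∀ z, costProcess r p p' c 0 z ≠ ∞) (t : Fin (T + 1)) :
    ∀ᵐ z ∂gluedMeasure K, costProcess r p p' c t z ≠ ∞ := by
  filter_upwards [ae_lt_top' (aemeasurable_costProcess_rpow hr hc hK t)
    (lintegral_costProcess_rpow_ne_top hr hc hK hfin t)] with z hz htop
  rw [htop, ENNReal.top_rpow_of_pos (by linarith)] at hz
  exact lt_irrefl _ hz

theorem integrable_costProcess_rpow (hr : 1 ≤ r) (hc : Measurable c)
    (hK : ∀ t : Fin T, ∀ᵐ z ∂(glue K t t.is_lt.le), IsOptimalAt r p p' c K t z)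
    (hfin : ∀ z, costProcess r p p' c 0 z ≠ ∞) (t : Fin (T + 1)) :
    Integrable (fun z => (costProcess r p p' c t z).toReal ^ r) (gluedMeasure K) := by
  simp only [ENNReal.toReal_rpow]
  exact integrable_toReal_of_lintegral_ne_top (aemeasurable_costProcess_rpow hr hc hK t)
    (lintegral_costProcess_rpow_ne_top hr hc hK hfin t)

theorem setIntegral_costProcess_rpow (hr : 1 ≤ r) (hc : Measurable c)
    (hK : ∀ t : Fin T, ∀ᵐ z ∂(glue K t t.is_lt.le), IsOptimalAt r p p' c K t z)
    (hfin : ∀ z, costProcess r p p' c 0 z ≠ ∞)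
    {s t : Fin (T + 1)} (hst : s ≤ t) {A : Set (Hist Ξ T × Hist Ξ T)}
    (hA : MeasurableSet[productFiltration Ξ T s] A) :
    ∫ z in A, (costProcess r p p' c s z).toReal ^ r ∂gluedMeasure K =
      ∫ z in A, (costProcess r p p' c t z).toReal ^ r ∂gluedMeasure K := by
  have key : ∀ u : Fin (T + 1),
      ∫ z in A, (costProcess r p p' c u z).toReal ^ r ∂gluedMeasure K =
        (∫⁻ z in A, costProcess r p p' c u z ^ r ∂gluedMeasure K).toReal := by
    intro u
    simp only [ENNReal.toReal_rpow]
    have hm := aemeasurable_costProcess_rpow hr hc hK u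
    exact integral_toReal hm.restrict (ae_restrict_of_ae
      (ae_lt_top' hm (lintegral_costProcess_rpow_ne_top hr hc hK hfin u)))
  rw [key s, key t, setLIntegral_costProcess_rpow hr hc hK hst hA]

theorem aestronglyMeasurable_costProcess_rpow (hr : 1 ≤ r) (hc : Measurable c)
    (hK : ∀ t : Fin T, ∀ᵐ z ∂(glue K t t.is_lt.le), IsOptimalAt r p p' c K t z)
    (t : Fin (T + 1)) :
    AEStronglyMeasurable[productFiltration Ξ T t]
      (fun z => (costProcess r p p' c t z).toReal ^ r) (gluedMeasure K) := by
  have h := aemeasurable_costFun_rpow hr hc hK t t.is_le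
  -- The version is chosen on histories up to `t` and then pulled back, which makes it adapted.
  refine ⟨fun z => (h.mk _ (truncPair t.is_le z)).toReal, ?_, ?_⟩
  · rw [productFiltration_apply]
    exact (h.measurable_mk.ennreal_toReal.comp (comap_measurable _)).stronglyMeasurable
  · have hmp : MeasurePreserving (truncPair t.is_le) (gluedMeasure K) (glue K t t.is_le) :=
      ⟨measurable_truncPair _, map_truncPair_glue K T t.is_le le_rfl⟩
    filter_upwards [hmp.quasiMeasurePreserving.ae h.ae_eq_mk] with z hz
    rw [ENNReal.toReal_rpow]
    exact congrArg ENNReal.toReal hz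

theorem stronglyMeasurable_costProcess_rpow (hr : 1 ≤ r) (hc : Measurable c)
    (hK : ∀ t z, IsOptimalAt r p p' c K t z) (t : Fin (T + 1)) :
    StronglyMeasurable[productFiltration Ξ T t]
      (fun z => (costProcess r p p' c t z).toReal ^ r) := by
  simp only [ENNReal.toReal_rpow]
  rw [productFiltration_apply]
  exact ((measurable_costFun_rpow hr hc hK t t.is_le).ennreal_toReal.comp
    (comap_measurable _)).stronglyMeasurable

theorem costProcess_rpow_ae_eq_condExp (hr : 1 ≤ r) (hc : Measurable c)
    (hK : ∀ t : Fin T, ∀ᵐ z ∂(glue K t t.is_lt.le), IsOptimalAt r p p' c K t z)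
    (hfin : ∀ z, costProcess r p p' c 0 z ≠ ∞) {s t : Fin (T + 1)} (hst : s ≤ t) :
    (fun z => (costProcess r p p' c s z).toReal ^ r) =ᵐ[gluedMeasure K]
      (gluedMeasure K)[fun z => (costProcess r p p' c t z).toReal ^ r |
        productFiltration Ξ T s] := by
  have hprob : IsProbabilityMeasure (gluedMeasure K) := isProbabilityMeasure_glue K T le_rfl
  exact ae_eq_condExp_of_forall_setIntegral_eq ((productFiltration Ξ T).le s)
    (integrable_costProcess_rpow hr hc hK hfin t)
    (fun A _ _ => (integrable_costProcess_rpow hr hc hK hfin s).integrableOn)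
    (fun A hA _ => setIntegral_costProcess_rpow hr hc hK hfin hst hA)
    (aestronglyMeasurable_costProcess_rpow hr hc hK s)

end cost
end

theorem mainTheorem3 {T : ℕ} {Ξ : ℕ → Type*}
    [∀ t, TopologicalSpace (Ξ t)] [∀ t, PolishSpace (Ξ t)]
    [∀ t, MeasurableSpace (Ξ t)] [∀ t, BorelSpace (Ξ t)]
    (r : ℝ) (hr : 1 ≤ r)
    (c : Hist Ξ T × Hist Ξ T → ℝ) (hc : LowerSemicontinuous c) (hc_nonneg : ∀ z, 0 ≤ c z)
    (P P' : Measure (Hist Ξ T)) [IsProbabilityMeasure P] [IsProbabilityMeasure P']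
    (p p' : (t : Fin T) → Kernel (Hist Ξ t) (Ξ t))
    [∀ t, IsMarkovKernel (p t)] [∀ t, IsMarkovKernel (p' t)]
    (hp : IsRegularKernelFamily P p) (hp' : IsRegularKernelFamily P' p')
    (K : (t : Fin T) → Kernel (Hist Ξ t × Hist Ξ t) (Ξ t × Ξ t)) [∀ t, IsMarkovKernel (K t)]
    (hK : ∀ t : Fin T, ∀ᵐ z ∂(glue K t t.is_lt.le), IsOptimalAt r p p' c K t z)
    (hfin : ∀ z, costProcess r p p' c 0 z ≠ ∞) :
    (∀ t, ∀ᵐ z ∂(gluedMeasure K), costProcess r p p' c t z ≠ ∞) ∧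
    (∀ t, Integrable (fun z => (costProcess r p p' c t z).toReal ^ r) (gluedMeasure K)) ∧
    (∀ t, AEStronglyMeasurable[productFiltration Ξ T t]
      (fun z => (costProcess r p p' c t z).toReal ^ r) (gluedMeasure K)) ∧
    (∀ s t, s ≤ t →
      (fun z => (costProcess r p p' c s z).toReal ^ r) =ᵐ[gluedMeasure K]
        (gluedMeasure K)[fun z => (costProcess r p p' c t z).toReal ^ r |
          productFiltration Ξ T s]) ∧
    ((∀ t z, IsOptimalAt r p p' c K t z) →
      Martingale (fun t z => (costProcess r p p' c t z).toReal ^ r)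
        (productFiltration Ξ T) (gluedMeasure K)) := by
  -- Lower semicontinuity enters only through Borel measurability.
  have hcm : Measurable c := hc.measurable
  exact ⟨ae_costProcess_ne_top hr hcm hK hfin, integrable_costProcess_rpow hr hcm hK hfin,
    aestronglyMeasurable_costProcess_rpow hr hcm hK,
    fun s t hst => costProcess_rpow_ae_eq_condExp hr hcm hK hfin hst,
    fun hopt => ⟨stronglyMeasurable_costProcess_rpow hr hcm hopt,
      fun s t hst => (costProcess_rpow_ae_eq_condExp hr hcm hK hfin hst).symm⟩⟩
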